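/- Graphs are finite and directed, and may have loops and multiple edges; $E_I^J(G)$ is the set of edges of $G$ from $I$ to $J$, and $F(I)$ is the set of terminal vertices of the edges that start at $I$. A right resolver $\Phi:G\to H$ is a graph homomorphism, surjective on vertices and edges, that for every vertex $I$ of $G$ maps the edges starting at $I$ bijectively onto the edges starting at $\partial\Phi(I)$, where $\partial\Phi$ is the vertex map. Write $H\le_R G$ if there is a right resolver $G\to H$. For a path $w$ of $H$ starting at $\partial\Phi(I)$, let $I\cdot_\Phi w$ be the end of the unique path of $G$ that starts at $I$ and is mapped to $w$. Two vertices $I_1,I_2$ with $\partial\Phi(I_1)=\partial\Phi(I_2)=I$ are stable if for every path $u$ of $H$ starting at $I$ there is a path $v$ of $H$ starting at the end of $u$ with $I_1\cdot_\Phi uv=I_2\cdot_\Phi uv$. The right resolver $\Phi$ is synchronizing if any two vertices in the same fibre of $\partial\Phi$ are stable; write $H\le_S G$ if there is a synchronizing right resolver $G\to H$. Let $M(G)$ be the (up to isomorphism unique) $\le_R$-minimal graph with $M(G)\le_R G$, and let $\Sigma_G:V(G)\to V(M(G))$ be the common vertex map of all right resolvers $G\to M(G)$. The graph $G$ is bunchy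 if, for every vertex $I'$ of $G$, $\Sigma_G$ restricts to a bijection $F(I')\to F(\Sigma_G(I'))$. It is weakly almost bunchy if, for all vertices $I,J$ of $M(G)$ with $|E_I^J(M(G))|\ge 2$, there is at most one $I'\in\Sigma_G^{-1}(I)$ with $|\Sigma_G^{-1}(J)\cap F(I')|=|E_I^J(M(G))|$. Proposition. Let $G$ be a strongly connected weakly almost bunchy graph. Then the set of bunchy graphs $H$ with $H\le_R G$ has a $\le_R$-maximal element $B(G)$, which is unique up to isomorphism, and $B(G)\le_S G$. In particular, $G$ has a bunchy synchronizing factor. -/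

import Mathlib

universe u v

/-- A finite directed multigraph: loops and multiple edges are allowed. -/
structure FinDigraph where
  /-- the vertices -/
  V : Type u
  /-- the edges -/
  E : Type v
  /-- the initial vertex of an edge -/
  src : E → V
  /-- the terminal vertex of an edge -/
  tgt : E → V
  finite_V : Finite V
  finite_E : Finite E

attribute [instance] FinDigraph.finite_V FinDigraph.finite_E

namespace FinDigraph

/-- The outgoing edges `E_I(G)` of a vertex. -/
def outEdges (G : FinDigraph.{u, v}) (I : G.V) : Set G.E := {e | G.src e = I}

/-- The edges `E_I^J(G)` from `I` to `J`. -/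
def edgesBetween (G : FinDigraph.{u, v}) (I J : G.V) : Set G.E :=
  {e | G.src e = I ∧ G.tgt e = J}

/-- The follower states `F(I)` of a vertex. -/
def followers (G : FinDigraph.{u, v}) (I : G.V) : Set G.V := G.tgt '' G.outEdges I

/-- `G.IsPath I w J`: the list of edges `w` is a (possibly empty) directed path from `I` to `J`. -/
def IsPath (G : FinDigraph.{u, v}) : G.V → List G.E → G.V → Prop
  | I, [], J => I = J
  | I, e :: w, J => G.src e = I ∧ G.IsPath (G.tgt e) w J

/-- There is a directed path from every vertex to every vertex. -/
def StronglyConnected (G : FinDigraph.{u, v}) : Prop :=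
  ∀ I J : G.V, ∃ w : List G.E, G.IsPath I w J

/-- A homomorphism of directed multigraphs: a vertex map and an edge map that respect initial and
terminal vertices. -/
structure Hom (G H : FinDigraph.{u, v}) where
  /-- the vertex map -/
  onV : G.V → H.V
  /-- the edge map -/
  onE : G.E → H.E
  src_onE : ∀ e, H.src (onE e) = onV (G.src e)
  tgt_onE : ∀ e, H.tgt (onE e) = onV (G.tgt e)

/-- `G` and `H` are isomorphic. -/
def Isomorphic (G H : FinDigraph.{u, v}) : Prop :=
  ∃ Φ : Hom G H, Function.Bijective Φ.onV ∧ Function.Bijective Φ.onE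

/-- A right resolver: a surjective homomorphism that maps the outgoing edges of each vertex `I`
bijectively onto the outgoing edges of the image of `I`. -/
structure RightResolver (G H : FinDigraph.{u, v}) extends Hom G H where
  surjective_onV : Function.Surjective onV
  surjective_onE : Function.Surjective onE
  bijOn_outEdges : ∀ I, Set.BijOn onE (G.outEdges I) (H.outEdges (onV I))

/-- `RFactor H G` is the relation `H ≤_R G`: there is a right resolver from `G` to `H`. -/
def RFactor (H G : FinDigraph.{u, v}) : Prop := Nonempty (RightResolver G H)

namespace RightResolver

variable {G H : FinDigraph.{u, v}}

/-- `Φ.LiftsTo I w J` says `I ·_Φ w = J`: the path of `G` that starts at `I` and is mapped to `w`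
by `Φ` ends at `J`. For a path `w` of `H` that starts at the image of `I` there is exactly one
such `J`. -/
def LiftsTo (Φ : RightResolver G H) (I : G.V) (w : List H.E) (J : G.V) : Prop :=
  ∃ p : List G.E, G.IsPath I p J ∧ p.map Φ.onE = w

/-- The stability relation of `Φ`: two vertices of one fibre are stable if every path `u` that
starts at their image extends to a path `uv` along which both are moved to the same vertex. -/
def Stable (Φ : RightResolver G H) (I₁ I₂ : G.V) : Prop :=
  Φ.onV I₁ = Φ.onV I₂ ∧
    ∀ (u : List H.E) (K : H.V), H.IsPath (Φ.onV I₁) u K →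
      ∃ (v : List H.E) (L : H.V), H.IsPath K v L ∧
        ∃ J : G.V, Φ.LiftsTo I₁ (u ++ v) J ∧ Φ.LiftsTo I₂ (u ++ v) J

/-- `Φ` is synchronizing if the classes of its stability relation are the entire fibres. -/
def IsSynchronizing (Φ : RightResolver G H) : Prop :=
  ∀ I₁ I₂ : G.V, Φ.onV I₁ = Φ.onV I₂ → Φ.Stable I₁ I₂

end RightResolver

/-- `SFactor H G` is the relation `H ≤_S G`: there is a synchronizing right resolver from `G`
to `H`. -/
def SFactor (H G : FinDigraph.{u, v}) : Prop :=
  ∃ Φ : RightResolver G H, Φ.IsSynchronizing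

theorem RFactor.refl (G : FinDigraph.{u, v}) : RFactor G G :=
  ⟨{ onV := id, onE := id, src_onE := fun _ => rfl, tgt_onE := fun _ => rfl,
     surjective_onV := Function.surjective_id, surjective_onE := Function.surjective_id,
     bijOn_outEdges := fun _ => Set.bijOn_id _ }⟩

theorem RFactor.trans {K H G : FinDigraph.{u, v}} (h₁ : RFactor K H) (h₂ : RFactor H G) :
    RFactor K G := by
  obtain ⟨Ψ⟩ := h₁
  obtain ⟨Φ⟩ := h₂
  exact ⟨{ onV := Ψ.onV ∘ Φ.onV, onE := Ψ.onE ∘ Φ.onE,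
           src_onE := fun e => by simp [Ψ.src_onE, Φ.src_onE],
           tgt_onE := fun e => by simp [Ψ.tgt_onE, Φ.tgt_onE],
           surjective_onV := Ψ.surjective_onV.comp Φ.surjective_onV,
           surjective_onE := Ψ.surjective_onE.comp Φ.surjective_onE,
           bijOn_outEdges := fun I =>
             (Ψ.bijOn_outEdges (Φ.onV I)).comp (Φ.bijOn_outEdges I) }⟩

/-- A right resolver between graphs of the same size can be inverted. -/
theorem RFactor.symm_of_card_le {H G : FinDigraph.{u, v}} (h : RFactor H G)
    (hc : Nat.card G.V ≤ Nat.card H.V) : RFactor G H := by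
  obtain ⟨Φ⟩ := h
  have hV : Function.Bijective Φ.onV :=
    (Nat.bijective_iff_surjective_and_card _).2
      ⟨Φ.surjective_onV, le_antisymm hc (Nat.card_le_card_of_surjective _ Φ.surjective_onV)⟩
  have hE : Function.Bijective Φ.onE := by
    refine ⟨fun e f hef => ?_, Φ.surjective_onE⟩
    have hs : G.src e = G.src f := hV.1 (by rw [← Φ.src_onE, ← Φ.src_onE, hef])
    exact (Φ.bijOn_outEdges (G.src f)).injOn hs rfl hef
  let a := Equiv.ofBijective _ hV
  let b := Equiv.ofBijective _ hE
  have hb : ∀ e, Φ.onE (b.symm e) = e := b.apply_symm_apply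
  have ha : ∀ I, Φ.onV (a.symm I) = I := a.apply_symm_apply
  have hsrc : ∀ e, G.src (b.symm e) = a.symm (H.src e) := fun e =>
    hV.1 (by rw [← Φ.src_onE, hb, ha])
  have htgt : ∀ e, G.tgt (b.symm e) = a.symm (H.tgt e) := fun e =>
    hV.1 (by rw [← Φ.tgt_onE, hb, ha])
  refine ⟨{ onV := a.symm, onE := b.symm, src_onE := hsrc, tgt_onE := htgt,
            surjective_onV := a.symm.surjective, surjective_onE := b.symm.surjective,
            bijOn_outEdges := fun I => ⟨?_, b.symm.injective.injOn, ?_⟩ }⟩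
  · intro e he
    change H.src e = I at he
    change G.src (b.symm e) = a.symm I
    rw [hsrc, he]
  · intro e he
    change G.src e = a.symm I at he
    refine ⟨Φ.onE e, ?_, b.symm_apply_apply e⟩
    change H.src (Φ.onE e) = I
    rw [Φ.src_onE, he, ha]

/-- `M` is a `≤_R`-minimal graph with `M ≤_R G`. -/
def IsMinimalFactor (G M : FinDigraph.{u, v}) : Prop :=
  RFactor M G ∧ ∀ H : FinDigraph.{u, v}, RFactor H M → RFactor M H

theorem exists_isMinimalFactor (G : FinDigraph.{u, v}) :
    ∃ M : FinDigraph.{u, v}, IsMinimalFactor G M := by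
  obtain ⟨M, hM, hmin⟩ := (measure fun H : FinDigraph.{u, v} => Nat.card H.V).wf.has_min
    {H | RFactor H G} ⟨G, RFactor.refl G⟩
  exact ⟨M, hM, fun H hH => hH.symm_of_card_le (not_lt.1 (hmin H (hH.trans hM)))⟩

/-- The minimal right resolving factor `M(G)`, which is unique up to isomorphism. -/
noncomputable def minimalFactor (G : FinDigraph.{u, v}) : FinDigraph.{u, v} :=
  (exists_isMinimalFactor G).choose

/-- The vertex map `Σ_G` from `G` to `M(G)`, which is the common vertex map of all right resolvers
from `G` to `M(G)`. -/
noncomputable def minimalMap (G : FinDigraph.{u, v}) : G.V → G.minimalFactor.V :=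
  (exists_isMinimalFactor G).choose_spec.1.some.onV

/-- `G` is bunchy: for every vertex `I'`, the map `Σ_G` restricts to a bijection from `F(I')` to
`F(Σ_G(I'))`. -/
def Bunchy (G : FinDigraph.{u, v}) : Prop :=
  ∀ I' : G.V,
    Set.BijOn G.minimalMap (G.followers I') (G.minimalFactor.followers (G.minimalMap I'))

/-- `G` is weakly almost bunchy: for all `I`, `J` in `M(G)` with at least two edges from `I` to
`J`, there is at most one `I'` over `I` that has as many follower states over `J` as there are
edges from `I` to `J` in `M(G)`. -/
def WeaklyAlmostBunchy (G : FinDigraph.{u, v}) : Prop :=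
  ∀ I J : G.minimalFactor.V, 2 ≤ (G.minimalFactor.edgesBetween I J).ncard →
    {I' : G.V | G.minimalMap I' = I ∧
      (G.minimalMap ⁻¹' {J} ∩ G.followers I').ncard =
        (G.minimalFactor.edgesBetween I J).ncard}.Subsingleton

/-- `B` is a `≤_R`-maximal element of the set of bunchy right resolving factors of `G`. -/
def IsMaximalBunchyFactor (G B : FinDigraph.{u, v}) : Prop :=
  RFactor B G ∧ Bunchy B ∧
    ∀ H : FinDigraph.{u, v}, RFactor H G → Bunchy H → RFactor B H → RFactor H B

end FinDigraph

/-!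
Fix the vertex map `Σ : G → M(G)`. A right resolver `Φ : G → M(G)` is a labelling of the edges of
`G` by parallel edges of `M(G)`, and it can be changed at each vertex by permuting labels among
parallel edges.

Among the fibre partitions of right resolvers on `G`, that of `Σ` is the coarsest
(`onV_eq_of_minimal`). Hence the right resolvers from `G` to bunchy graphs have as kernels the
equivalence relations `s` that refine the fibres of `Σ` and satisfy: if `s I I'`, then all followers
of `I` and `I'` over one vertex of `M(G)` are related (`IsBunched`). These relations are closed
under intersection, and `B(G)` is the quotient by the finest one. Every bunchy factor of `G` is a
factor of `B(G)`, which gives maximality and uniqueness.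

It remains to find a labelling for which the stability relation is bunched, for then it contains
the kernel of `G → B(G)`. As stability is compatible with equal labels, it suffices that any two
followers of a vertex over one vertex of `M(G)` are stable (`exists_forall_stable`). If two such
followers are distinct, consider the edges from `I` to `J` in `M(G)` over which they occur. By weak
almost bunchiness there is a vertex `x` over `I` with two distinct followers over `J`, such that
every other vertex over `I` has two parallel edges over `J`. Relabel so that two labels `a` and `b`
lead from each vertex over `I` other than `x` to the same vertex, but lead from `x` to distinct
vertices. Among the images of full fibres under paths, take one of minimal cardinality that contains
`x`, and move it along `a` and along `b`: this gives two images of minimal cardinality that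
differ in at most one element each, and so `x · a` and `x · b` are stable
(`stable_step_of_step_eq`). Pass to the quotient by stability, which is again weakly almost
bunchy, and use induction on the number of vertices.
-/

namespace FinDigraph

open Set

variable {G H K M : FinDigraph.{u, v}}

/-! ### Counting edges and constructing right resolvers -/

/-- The edges that start at `I` and end in the set `S`. -/
def edgesInto (G : FinDigraph.{u, v}) (I : G.V) (S : Set G.V) : Set G.E :=
  {e | G.src e = I ∧ G.tgt e ∈ S}

theorem RightResolver.exists_lift (Φ : RightResolver G H) {I : G.V} {a : H.E}
    (h : H.src a = Φ.onV I) : ∃ e, G.src e = I ∧ Φ.onE e = a :=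
  (Φ.bijOn_outEdges I).surjOn h

theorem RightResolver.eq_of_onE_eq (Φ : RightResolver G H) {e e' : G.E}
    (hs : G.src e = G.src e') (h : Φ.onE e = Φ.onE e') : e = e' :=
  (Φ.bijOn_outEdges (G.src e')).injOn hs rfl h

theorem RightResolver.bijOn_edgesInto (Φ : RightResolver G H) (I : G.V) (S : Set H.V) :
    BijOn Φ.onE (G.edgesInto I (Φ.onV ⁻¹' S)) (H.edgesInto (Φ.onV I) S) := by
  refine ⟨?_, ?_, ?_⟩
  · rintro e ⟨rfl, he⟩
    exact ⟨Φ.src_onE e, by rw [Φ.tgt_onE]; exact he⟩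
  · rintro e ⟨he, -⟩ e' ⟨he', -⟩ h
    exact Φ.eq_of_onE_eq (he.trans he'.symm) h
  · rintro a ⟨ha, haS⟩
    obtain ⟨e, he, rfl⟩ := Φ.exists_lift ha
    exact ⟨e, ⟨he, by rw [Φ.tgt_onE] at haS; exact haS⟩, rfl⟩

theorem RightResolver.ncard_edgesInto (Φ : RightResolver G H) (I : G.V) (S : Set H.V) :
    (G.edgesInto I (Φ.onV ⁻¹' S)).ncard = (H.edgesInto (Φ.onV I) S).ncard := by
  rw [← (Φ.bijOn_edgesInto I S).image_eq, (Φ.bijOn_edgesInto I S).injOn.ncard_image]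

/-- A homomorphism that is surjective on vertices and bijective on outgoing edges is a right
resolver, because it is then surjective on edges. -/
def Hom.toRightResolver (Φ : Hom G H) (hV : Function.Surjective Φ.onV)
    (hE : ∀ I, BijOn Φ.onE (G.outEdges I) (H.outEdges (Φ.onV I))) : RightResolver G H where
  toHom := Φ
  surjective_onV := hV
  surjective_onE a := by
    obtain ⟨I, hI⟩ := hV (H.src a)
    obtain ⟨e, -, he⟩ := (hE I).surjOn (show H.src a = Φ.onV I from hI.symm)
    exact ⟨e, he⟩
  bijOn_outEdges := hE

/-- Composition of right resolvers. -/
def RightResolver.comp (Θ : RightResolver H K) (Φ : RightResolver G H) : RightResolver G K where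
  onV := Θ.onV ∘ Φ.onV
  onE := Θ.onE ∘ Φ.onE
  src_onE e := by simp [Θ.src_onE, Φ.src_onE]
  tgt_onE e := by simp [Θ.tgt_onE, Φ.tgt_onE]
  surjective_onV := Θ.surjective_onV.comp Φ.surjective_onV
  surjective_onE := Θ.surjective_onE.comp Φ.surjective_onE
  bijOn_outEdges I := (Θ.bijOn_outEdges (Φ.onV I)).comp (Φ.bijOn_outEdges I)

theorem RightResolver.ext {Φ Ψ : RightResolver G H} (hV : Φ.onV = Ψ.onV) (hE : Φ.onE = Ψ.onE) :
    Φ = Ψ := by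
  rcases Φ with ⟨⟨_, _, _, _⟩, _, _, _⟩
  rcases Ψ with ⟨⟨_, _, _, _⟩, _, _, _⟩
  cases hV
  cases hE
  rfl

/-- A surjective vertex map that respects the numbers of edges is the vertex map of a right
resolver. -/
theorem exists_rightResolver_onV_eq (f : G.V → H.V) (hf : Function.Surjective f)
    (hc : ∀ I J, (G.edgesInto I (f ⁻¹' {J})).ncard = (H.edgesInto (f I) {J}).ncard) :
    ∃ Φ : RightResolver G H, Φ.onV = f := by
  have hne (I : G.V) (J : H.V) :
      Nonempty (G.edgesInto I (f ⁻¹' {J}) ≃ H.edgesInto (f I) {J}) :=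
    Finite.card_eq.1 (hc I J)
  let φ : ∀ I J, G.edgesInto I (f ⁻¹' {J}) ≃ H.edgesInto (f I) {J} := fun I J => (hne I J).some
  let onE : G.E → H.E := fun e => (φ (G.src e) (f (G.tgt e)) ⟨e, rfl, rfl⟩).1
  have honE : ∀ I J e (h : e ∈ G.edgesInto I (f ⁻¹' {J})), onE e = (φ I J ⟨e, h⟩).1 := by
    rintro _ _ e ⟨rfl, rfl⟩
    rfl
  have hsrc : ∀ e, H.src (onE e) = f (G.src e) := fun e => (φ _ _ ⟨e, rfl, rfl⟩).2.1
  have htgt : ∀ e, H.tgt (onE e) = f (G.tgt e) := fun e => (φ _ _ ⟨e, rfl, rfl⟩).2.2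
  refine ⟨Hom.toRightResolver ⟨f, onE, hsrc, htgt⟩ hf fun I => ⟨?_, ?_, ?_⟩, rfl⟩
  · rintro e rfl
    exact hsrc e
  · intro e he e' he' h
    have ht : f (G.tgt e) = f (G.tgt e') := by rw [← htgt, ← htgt]; exact congrArg H.tgt h
    have h₁ := honE I (f (G.tgt e')) e ⟨he, ht⟩
    have h₂ := honE I (f (G.tgt e')) e' ⟨he', rfl⟩
    have := (φ I (f (G.tgt e'))).injective (Subtype.ext (h₁.symm.trans (h.trans h₂)))
    exact congrArg Subtype.val this
  · intro a ha
    obtain ⟨⟨e, he⟩, hea⟩ := (φ I (H.tgt a)).surjective ⟨a, ha, rfl⟩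
    exact ⟨e, he.1, (honE _ _ e he).trans (congrArg Subtype.val hea)⟩

theorem RightResolver.exists_factor (Φ : RightResolver G K) (Ψ : RightResolver G H)
    (h : ∀ I I', Φ.onV I = Φ.onV I' → Ψ.onV I = Ψ.onV I') :
    ∃ Θ : RightResolver K H, ∀ I, Θ.onV (Φ.onV I) = Ψ.onV I := by
  let g : K.V → H.V := fun c => Ψ.onV (Function.surjInv Φ.surjective_onV c)
  have hg : ∀ I, g (Φ.onV I) = Ψ.onV I := fun I => h _ _ (Function.surjInv_eq _ _)
  obtain ⟨Θ, hΘ⟩ := exists_rightResolver_onV_eq g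
    (fun J => by
      obtain ⟨I, rfl⟩ := Ψ.surjective_onV J
      exact ⟨_, hg I⟩)
    (fun c J => by
      obtain ⟨I, rfl⟩ := Φ.surjective_onV c
      rw [← Φ.ncard_edgesInto, hg, ← Ψ.ncard_edgesInto, ← preimage_comp]
      congr 3
      exact funext hg)
  exact ⟨Θ, fun I => by rw [hΘ, hg]⟩

/-! ### Quotient graphs -/

/-- The quotient of `G` by an equivalence relation on its vertices. Its edges are the edges of `G`
that start at the chosen representative of their class. -/
def quot (G : FinDigraph.{u, v}) (s : Setoid G.V) : FinDigraph.{u, v} where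
  V := Quotient s
  E := {e : G.E // G.src e = (Quotient.mk s (G.src e)).out}
  src e := Quotient.mk s (G.src e.1)
  tgt e := Quotient.mk s (G.tgt e.1)
  finite_V := inferInstance
  finite_E := inferInstance

/-- `G` maps onto its quotient by an equitable partition. -/
theorem exists_rightResolver_quot (s : Setoid G.V)
    (hs : ∀ I I', s I I' → ∀ C : Quotient s,
      (G.edgesInto I (Quotient.mk s ⁻¹' {C})).ncard =
        (G.edgesInto I' (Quotient.mk s ⁻¹' {C})).ncard) :
    ∃ Φ : RightResolver G (G.quot s), Φ.onV = Quotient.mk s := by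
  refine exists_rightResolver_onV_eq (H := G.quot s) _ Quotient.mk_surjective fun I C => ?_
  have h : Subtype.val '' (G.quot s).edgesInto (Quotient.mk s I) {C} =
      G.edgesInto (Quotient.mk s I).out (Quotient.mk s ⁻¹' {C}) := by
    ext e
    constructor
    · rintro ⟨⟨e, he⟩, ⟨h₁, h₂⟩, rfl⟩
      change Quotient.mk s (G.src e) = Quotient.mk s I at h₁
      exact ⟨by rw [← h₁]; exact he, h₂⟩
    · rintro ⟨h₁, h₂⟩
      have h₃ : Quotient.mk s (G.src e) = Quotient.mk s I := by rw [h₁, Quotient.out_eq]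
      exact ⟨⟨e, by rw [h₃]; exact h₁⟩, ⟨h₃, h₂⟩, rfl⟩
  have hi := ncard_image_of_injective ((G.quot s).edgesInto (Quotient.mk s I) {C})
    Subtype.val_injective
  exact (hs _ _ (s.symm (Quotient.mk_out I)) C).trans ((congrArg ncard h).symm.trans hi)

/-- A right resolver factors, on vertices and on edges, through the quotient by a congruence that
refines its fibres. -/
theorem RightResolver.exists_factor_quot (Φ : RightResolver G H) (s : Setoid G.V)
    (hs : ∀ I I', s I I' → Φ.onV I = Φ.onV I')
    (hc : ∀ e e', s (G.src e) (G.src e') → Φ.onE e = Φ.onE e' → s (G.tgt e) (G.tgt e')) :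
    ∃ (Ψ : RightResolver G (G.quot s)) (Θ : RightResolver (G.quot s) H),
      Ψ.onV = Quotient.mk s ∧ Θ.comp Ψ = Φ := by
  have hlift (e : G.E) : ∃ e' : (G.quot s).E,
      Quotient.mk s (G.src e'.1) = Quotient.mk s (G.src e) ∧ Φ.onE e'.1 = Φ.onE e := by
    have hr : s (Quotient.mk s (G.src e)).out (G.src e) := Quotient.mk_out _
    obtain ⟨e', h₁, h₂⟩ := Φ.exists_lift (I := (Quotient.mk s (G.src e)).out) (a := Φ.onE e)
      (by rw [Φ.src_onE, hs _ _ hr])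
    have h₃ : Quotient.mk s (G.src e') = Quotient.mk s (G.src e) := by rw [h₁, Quotient.out_eq]
    exact ⟨⟨e', by rw [h₃]; exact h₁⟩, h₃, h₂⟩
  choose f hf hfΦ using hlift
  have huniq (a b : (G.quot s).E) (h : Quotient.mk s (G.src a.1) = Quotient.mk s (G.src b.1))
      (h' : Φ.onE a.1 = Φ.onE b.1) : a = b :=
    Subtype.ext (Φ.eq_of_onE_eq (by rw [a.2, b.2, h]) h')
  refine ⟨Hom.toRightResolver ⟨Quotient.mk s, f, hf, fun e => ?_⟩ Quotient.mk_surjective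
    fun I => ⟨?_, ?_, ?_⟩,
    Hom.toRightResolver ⟨Quotient.lift Φ.onV hs, fun e => Φ.onE e.1, fun e => Φ.src_onE e.1,
      fun e => Φ.tgt_onE e.1⟩ ?_ fun C => ⟨?_, ?_, ?_⟩, rfl, ext rfl (funext hfΦ)⟩
  · exact Quotient.sound (hc _ _ (Quotient.exact (hf e)) (hfΦ e))
  · rintro e rfl
    exact hf e
  · rintro e he e' he' h
    have hΦ := congrArg (fun a : (G.quot s).E => Φ.onE a.1) h
    exact Φ.eq_of_onE_eq (he.trans he'.symm) ((hfΦ e).symm.trans (hΦ.trans (hfΦ e')))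
  · intro a ha
    change Quotient.mk s (G.src a.1) = Quotient.mk s I at ha
    obtain ⟨e, he, hea⟩ := Φ.exists_lift (I := I) (a := Φ.onE a.1)
      (by rw [Φ.src_onE]; exact hs _ _ (Quotient.exact ha))
    exact ⟨e, he, huniq _ _ (by rw [hf, he, ha]) ((hfΦ e).trans hea)⟩
  · intro J
    obtain ⟨I, rfl⟩ := Φ.surjective_onV J
    exact ⟨Quotient.mk s I, rfl⟩
  · rintro a rfl
    exact Φ.src_onE a.1
  · intro a ha b hb h
    exact huniq a b (ha.trans hb.symm) h
  · intro a ha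
    induction C using Quotient.inductionOn with | h I => ?_
    obtain ⟨e, rfl, rfl⟩ := Φ.exists_lift ha
    exact ⟨f e, hf e, hfΦ e⟩

/-! ### The minimal factor -/

/-- Among the fibre partitions of the right resolvers on `G`, that of a minimal graph is the
coarsest: the join of two such partitions is equitable, so the quotient by it would otherwise be a
proper factor of the minimal graph. -/
theorem RightResolver.onV_eq_of_minimal (hM : ∀ H : FinDigraph.{u, v}, RFactor H M → RFactor M H)
    (σ : RightResolver G M) (Φ : RightResolver G H) {x y : G.V} (h : Φ.onV x = Φ.onV y) :
    σ.onV x = σ.onV y := by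
  let s : Setoid G.V := Relation.EqvGen.setoid fun x y => Φ.onV x = Φ.onV y ∨ σ.onV x = σ.onV y
  have hcount {L : FinDigraph.{u, v}} (Ψ : RightResolver G L)
      (hΨ : ∀ x y, Ψ.onV x = Ψ.onV y → s x y) (x y : G.V) (hxy : Ψ.onV x = Ψ.onV y)
      (C : Quotient s) : (G.edgesInto x (Quotient.mk s ⁻¹' {C})).ncard =
        (G.edgesInto y (Quotient.mk s ⁻¹' {C})).ncard := by
    have hS : Quotient.mk s ⁻¹' {C} = Ψ.onV ⁻¹' (Ψ.onV '' (Quotient.mk s ⁻¹' {C})) := by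
      refine (subset_preimage_image _ _).antisymm ?_
      rintro a ⟨b, rfl, hb⟩
      exact Quotient.sound (s.symm (hΨ _ _ hb))
    rw [hS, Ψ.ncard_edgesInto, Ψ.ncard_edgesInto, hxy]
  have hΦs : ∀ x y, Φ.onV x = Φ.onV y → s x y := fun x y h => .rel _ _ (.inl h)
  have hσs : ∀ x y, σ.onV x = σ.onV y → s x y := fun x y h => .rel _ _ (.inr h)
  obtain ⟨Ψ, hΨ⟩ := exists_rightResolver_quot s fun x y hxy C => by
    induction hxy with
    | rel x y hxy => exact hxy.elim (hcount Φ hΦs x y · C) (hcount σ hσs x y · C)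
    | refl x => rfl
    | symm x y _ ih => exact ih.symm
    | trans x y z _ _ ih₁ ih₂ => exact ih₁.trans ih₂
  obtain ⟨Θ, hΘ⟩ := σ.exists_factor Ψ fun x y hxy => by
    rw [hΨ]
    exact Quotient.sound (hσs x y hxy)
  obtain ⟨Θ'⟩ := hM _ ⟨Θ⟩
  have hinj : Function.Injective Θ.onV :=
    ((Nat.bijective_iff_surjective_and_card _).2 ⟨Θ.surjective_onV,
      le_antisymm (Nat.card_le_card_of_surjective _ Θ'.surjective_onV)
        (Nat.card_le_card_of_surjective _ Θ.surjective_onV)⟩).1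
  apply hinj
  rw [hΘ, hΘ, hΨ]
  exact Quotient.sound (hΦs x y h)

theorem exists_onV_eq_minimalMap (G : FinDigraph.{u, v}) :
    ∃ σ : RightResolver G G.minimalFactor, σ.onV = G.minimalMap :=
  ⟨_, rfl⟩

theorem RFactor.minimalFactor {H : FinDigraph.{u, v}} (h : RFactor H G.minimalFactor) :
    RFactor G.minimalFactor H :=
  (exists_isMinimalFactor G).choose_spec.2 H h

/-- Passing to a right resolving factor does not change the partition of `V(G)` into the fibres
over the minimal factor. -/
theorem RightResolver.minimalMap_eq_iff (Φ : RightResolver G H) {x y : G.V} :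
    H.minimalMap (Φ.onV x) = H.minimalMap (Φ.onV y) ↔ G.minimalMap x = G.minimalMap y := by
  obtain ⟨σ, hσ⟩ := exists_onV_eq_minimalMap G
  obtain ⟨τ, hτ⟩ := exists_onV_eq_minimalMap H
  rw [← hσ, ← hτ]
  exact ⟨σ.onV_eq_of_minimal (fun _ => RFactor.minimalFactor) (τ.comp Φ),
    (τ.comp Φ).onV_eq_of_minimal (fun _ => RFactor.minimalFactor) σ⟩

theorem bunchy_iff : Bunchy G ↔ ∀ e e', G.src e = G.src e' →
    G.minimalMap (G.tgt e) = G.minimalMap (G.tgt e') → G.tgt e = G.tgt e' := by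
  constructor
  · intro h e e' hs ht
    exact (h (G.src e')).injOn ⟨e, hs, rfl⟩ ⟨e', rfl, rfl⟩ ht
  · obtain ⟨σ, hσ⟩ := exists_onV_eq_minimalMap G
    rw [← hσ]
    intro h I
    rw [← hσ]
    refine ⟨?_, ?_, ?_⟩
    · rintro _ ⟨e, rfl, rfl⟩
      exact ⟨σ.onE e, σ.src_onE e, σ.tgt_onE e⟩
    · rintro _ ⟨e, he, rfl⟩ _ ⟨e', he', rfl⟩ ht
      exact h e e' (he.trans he'.symm) ht
    · rintro _ ⟨a, ha, rfl⟩
      obtain ⟨e, he, rfl⟩ := σ.exists_lift ha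
      exact ⟨_, ⟨e, he, rfl⟩, (σ.tgt_onE e).symm⟩

/-! ### The action of paths and stability -/

theorem isPath_append {I L : G.V} {u w : List G.E} :
    G.IsPath I (u ++ w) L ↔ ∃ J, G.IsPath I u J ∧ G.IsPath J w L := by
  induction u generalizing I with
  | nil => simp [IsPath]
  | cons e u ih => simp [IsPath, ih, and_assoc]

theorem Hom.isPath_map (Φ : Hom G H) {I J : G.V} {w : List G.E} (h : G.IsPath I w J) :
    H.IsPath (Φ.onV I) (w.map Φ.onE) (Φ.onV J) := by
  induction w generalizing I with
  | nil => exact congrArg Φ.onV h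
  | cons e w ih =>
    obtain ⟨rfl, h⟩ := h
    exact ⟨Φ.src_onE e, by rw [Φ.tgt_onE]; exact ih h⟩

theorem StronglyConnected.of_rightResolver (hG : G.StronglyConnected) (Φ : RightResolver G H) :
    H.StronglyConnected := by
  intro I J
  obtain ⟨I, rfl⟩ := Φ.surjective_onV I
  obtain ⟨J, rfl⟩ := Φ.surjective_onV J
  obtain ⟨w, hw⟩ := hG I J
  exact ⟨_, Φ.isPath_map hw⟩

namespace RightResolver

open Classical in
/-- The vertex `I ·_Φ a` for a single edge `a` of `H`. If `a` does not start at the image of `I`,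
the value is `I`. -/
noncomputable def step (Φ : RightResolver G H) (I : G.V) (a : H.E) : G.V :=
  if h : ∃ e, G.src e = I ∧ Φ.onE e = a then G.tgt h.choose else I

/-- The vertex `I ·_Φ w`, as a total function: it is meaningful if `w` is a path that starts at the
image of `I`. -/
noncomputable def act (Φ : RightResolver G H) (I : G.V) (w : List H.E) : G.V :=
  w.foldl Φ.step I

theorem step_onE (Φ : RightResolver G H) (e : G.E) : Φ.step (G.src e) (Φ.onE e) = G.tgt e := by
  have h : ∃ e', G.src e' = G.src e ∧ Φ.onE e' = Φ.onE e := ⟨e, rfl, rfl⟩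
  rw [step, dif_pos h, Φ.eq_of_onE_eq h.choose_spec.1 h.choose_spec.2]

theorem act_cons (Φ : RightResolver G H) (I : G.V) (a : H.E) (w : List H.E) :
    Φ.act I (a :: w) = Φ.act (Φ.step I a) w := rfl

theorem act_append (Φ : RightResolver G H) (I : G.V) (u w : List H.E) :
    Φ.act I (u ++ w) = Φ.act (Φ.act I u) w :=
  List.foldl_append

theorem act_map_onE (Φ : RightResolver G H) {I J : G.V} {p : List G.E} (h : G.IsPath I p J) :
    Φ.act I (p.map Φ.onE) = J := by
  induction p generalizing I with
  | nil => exact h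
  | cons e p ih =>
    obtain ⟨rfl, h⟩ := h
    rw [List.map_cons, act_cons, step_onE, ih h]

theorem exists_isPath_map_eq (Φ : RightResolver G H) {I : G.V} {w : List H.E} {L : H.V}
    (h : H.IsPath (Φ.onV I) w L) :
    ∃ p J, G.IsPath I p J ∧ p.map Φ.onE = w ∧ Φ.onV J = L := by
  induction w generalizing I with
  | nil => exact ⟨[], I, rfl, rfl, h⟩
  | cons a w ih =>
    obtain ⟨ha, h⟩ := h
    obtain ⟨e, rfl, rfl⟩ := Φ.exists_lift ha
    rw [Φ.tgt_onE] at h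
    obtain ⟨p, J, hp, rfl, hJ⟩ := ih h
    exact ⟨e :: p, J, ⟨rfl, hp⟩, rfl, hJ⟩

theorem liftsTo_act (Φ : RightResolver G H) {I : G.V} {w : List H.E} {L : H.V}
    (h : H.IsPath (Φ.onV I) w L) : Φ.LiftsTo I w (Φ.act I w) := by
  obtain ⟨p, J, hp, rfl, -⟩ := Φ.exists_isPath_map_eq h
  exact ⟨p, by rw [Φ.act_map_onE hp]; exact hp, rfl⟩

theorem onV_act (Φ : RightResolver G H) {I : G.V} {w : List H.E} {L : H.V}
    (h : H.IsPath (Φ.onV I) w L) : Φ.onV (Φ.act I w) = L := by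
  obtain ⟨p, J, hp, rfl, hJ⟩ := Φ.exists_isPath_map_eq h
  rw [Φ.act_map_onE hp, hJ]

theorem stable_iff (Φ : RightResolver G H) {I₁ I₂ : G.V} :
    Φ.Stable I₁ I₂ ↔ Φ.onV I₁ = Φ.onV I₂ ∧
      ∀ u K, H.IsPath (Φ.onV I₁) u K →
        ∃ w L, H.IsPath K w L ∧ Φ.act I₁ (u ++ w) = Φ.act I₂ (u ++ w) := by
  refine and_congr_right fun h => forall₃_congr fun u K hu => exists₂_congr fun w L =>
    and_congr_right fun hw => ⟨?_, fun heq => ?_⟩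
  · rintro ⟨J, ⟨p, hp, hpw⟩, ⟨q, hq, hqw⟩⟩
    rw [← hpw, Φ.act_map_onE hp, hpw, ← hqw, Φ.act_map_onE hq]
  · have huw := isPath_append.2 ⟨K, hu, hw⟩
    exact ⟨_, Φ.liftsTo_act huw, heq ▸ Φ.liftsTo_act (h ▸ huw)⟩

/-- The stability relation as an equivalence relation. -/
def stableSetoid (Φ : RightResolver G H) : Setoid G.V where
  r := Φ.Stable
  iseqv := by
    refine ⟨fun I => Φ.stable_iff.2 ⟨rfl, fun u K _ => ⟨[], K, rfl, rfl⟩⟩, fun {I₁ I₂} h => ?_,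
      fun {I₁ I₂ I₃} h h' => ?_⟩
    · rw [stable_iff] at h ⊢
      refine ⟨h.1.symm, fun u K hu => ?_⟩
      obtain ⟨w, L, hw, heq⟩ := h.2 u K (h.1 ▸ hu)
      exact ⟨w, L, hw, heq.symm⟩
    · rw [stable_iff] at h h' ⊢
      refine ⟨h.1.trans h'.1, fun u K hu => ?_⟩
      obtain ⟨w, L, hw, heq⟩ := h.2 u K hu
      obtain ⟨w', L', hw', heq'⟩ := h'.2 (u ++ w) L (h.1 ▸ isPath_append.2 ⟨K, hu, hw⟩)
      refine ⟨w ++ w', L', isPath_append.2 ⟨L, hw, hw'⟩, ?_⟩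
      rw [← List.append_assoc, act_append, heq, ← act_append, heq']

theorem Stable.tgt {Φ : RightResolver G H} {e e' : G.E} (h : Φ.Stable (G.src e) (G.src e'))
    (he : Φ.onE e = Φ.onE e') : Φ.Stable (G.tgt e) (G.tgt e') := by
  rw [stable_iff] at h ⊢
  refine ⟨by rw [← Φ.tgt_onE, ← Φ.tgt_onE, he], fun u K hu => ?_⟩
  obtain ⟨w, L, hw, heq⟩ := h.2 (Φ.onE e :: u) K
    ⟨Φ.src_onE e, by rw [Φ.tgt_onE]; exact hu⟩
  refine ⟨w, L, hw, ?_⟩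
  rwa [List.cons_append, act_cons, act_cons, step_onE, he, step_onE] at heq

section Comp

variable {Ψ : RightResolver G K} {Θ : RightResolver K H}

theorem act_comp_map {I : G.V} {w : List K.E} {L : K.V} (h : K.IsPath (Ψ.onV I) w L) :
    (Θ.comp Ψ).act I (w.map Θ.onE) = Ψ.act I w := by
  obtain ⟨p, J, hp, rfl, -⟩ := Ψ.exists_isPath_map_eq h
  rw [Ψ.act_map_onE hp, List.map_map]
  exact (Θ.comp Ψ).act_map_onE hp

theorem onV_act_comp {I : G.V} {w : List H.E} {L : H.V}
    (h : H.IsPath (Θ.onV (Ψ.onV I)) w L) :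
    Ψ.onV ((Θ.comp Ψ).act I w) = Θ.act (Ψ.onV I) w := by
  obtain ⟨p, J, hp, rfl, -⟩ := Θ.exists_isPath_map_eq h
  rw [act_comp_map hp, Θ.act_map_onE hp, Ψ.onV_act hp]

/-- If the fibres of `Ψ` are stable for a composition `Θ ∘ Ψ`, they are stable for `Ψ`. -/
theorem isSynchronizing_of_comp
    (h : ∀ I₁ I₂, Ψ.onV I₁ = Ψ.onV I₂ → (Θ.comp Ψ).Stable I₁ I₂) : Ψ.IsSynchronizing := by
  intro I₁ I₂ hI
  refine Ψ.stable_iff.2 ⟨hI, fun u J hu => ?_⟩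
  obtain ⟨w', L', hw', heq⟩ := ((Θ.comp Ψ).stable_iff.1 (h I₁ I₂ hI)).2 _ _ (Θ.isPath_map hu)
  obtain ⟨w, L, hw, rfl, -⟩ := Θ.exists_isPath_map_eq hw'
  have huw := isPath_append.2 ⟨J, hu, hw⟩
  refine ⟨w, L, hw, ?_⟩
  rwa [← List.map_append, act_comp_map huw, act_comp_map (hI ▸ huw)] at heq

/-- Stable pairs can be pulled back along a synchronizing right resolver. -/
theorem IsSynchronizing.stable_comp (hΨ : Ψ.IsSynchronizing) {I₁ I₂ : G.V}
    (h : Θ.Stable (Ψ.onV I₁) (Ψ.onV I₂)) : (Θ.comp Ψ).Stable I₁ I₂ := by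
  rw [stable_iff] at h
  refine (Θ.comp Ψ).stable_iff.2 ⟨h.1, fun u J hu => ?_⟩
  obtain ⟨w, L, hw, heq⟩ := h.2 u J hu
  have huw := isPath_append.2 ⟨J, hu, hw⟩
  rw [← onV_act_comp huw, ← onV_act_comp (h.1 ▸ huw)] at heq
  have hL : Θ.onV (Ψ.onV ((Θ.comp Ψ).act I₁ (u ++ w))) = L := (Θ.comp Ψ).onV_act huw
  obtain ⟨w', L', hw', heq'⟩ := (Ψ.stable_iff.1 (hΨ _ _ heq)).2 [] _ rfl
  refine ⟨w ++ w'.map Θ.onE, _, isPath_append.2 ⟨L, hw, hL ▸ Θ.isPath_map hw'⟩, ?_⟩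
  rw [← List.append_assoc, act_append, act_append _ I₂, act_comp_map hw',
    act_comp_map (heq ▸ hw')]
  exact heq'

end Comp

/-! ### Stable pairs from minimal images -/

/-- `Φ.IsImage L A` says that `A` is the image of a full fibre of `Φ` under a path that ends
at `L`. -/
def IsImage (Φ : RightResolver G H) (L : H.V) (A : Set G.V) : Prop :=
  ∃ I w, H.IsPath I w L ∧ A = (Φ.act · w) '' (Φ.onV ⁻¹' {I})

theorem IsImage.act {Φ : RightResolver G H} {L L' : H.V} {A : Set G.V} (hA : Φ.IsImage L A)
    {w : List H.E} (hw : H.IsPath L w L') : Φ.IsImage L' ((Φ.act · w) '' A) := by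
  obtain ⟨I, w₀, hw₀, rfl⟩ := hA
  refine ⟨I, w₀ ++ w, isPath_append.2 ⟨L, hw₀, hw⟩, ?_⟩
  rw [image_image]
  exact image_congr fun x _ => (Φ.act_append x w₀ w).symm

theorem IsImage.onV_eq {Φ : RightResolver G H} {L : H.V} {A : Set G.V} (hA : Φ.IsImage L A)
    {x : G.V} (hx : x ∈ A) : Φ.onV x = L := by
  obtain ⟨I, w, hw, rfl⟩ := hA
  obtain ⟨y, rfl, rfl⟩ := hx
  exact Φ.onV_act hw

/-- If two parallel edges `a`, `b` of `H` act alike on the whole fibre over their initial vertex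
except at one vertex `x`, then `x ·_Φ a` and `x ·_Φ b` are stable. Indeed, call an image of a
fibre minimal if its cardinality is the least possible. The images under `a` and `b` of a minimal
image that contains `x` are minimal images that share all elements except possibly these two, and
every path extends to one that maps a full fibre, hence both minimal images, onto one minimal
image. -/
theorem stable_step_of_step_eq (Φ : RightResolver G H) (hG : G.StronglyConnected) {x : G.V}
    {a b : H.E} (ha : H.src a = Φ.onV x) (hb : H.src b = Φ.onV x) (hab : H.tgt a = H.tgt b)
    (hstep : ∀ y, y ≠ x → Φ.onV y = Φ.onV x → Φ.step y a = Φ.step y b) :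
    Φ.Stable (Φ.step x a) (Φ.step x b) := by
  have hH := hG.of_rightResolver Φ
  obtain ⟨⟨L₀, A₀⟩, hA₀, hmin⟩ := (measure fun p : H.V × Set G.V => p.2.ncard).wf.has_min
    {p | Φ.IsImage p.1 p.2} ⟨⟨Φ.onV x, _⟩, Φ.onV x, [], rfl, rfl⟩
  replace hmin : ∀ L A, Φ.IsImage L A → A₀.ncard ≤ A.ncard :=
    fun L A hA => not_lt.1 (hmin (L, A) hA)
  change Φ.IsImage L₀ A₀ at hA₀
  -- a minimal image `A` over the image of `x` that contains `x`
  obtain ⟨A, hA, hxA, hAc⟩ : ∃ A, Φ.IsImage (Φ.onV x) A ∧ x ∈ A ∧ A.ncard = A₀.ncard := by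
    have hne : A₀.Nonempty := by
      obtain ⟨I, w, -, rfl⟩ := hA₀
      obtain ⟨y, hy⟩ := Φ.surjective_onV I
      exact ⟨_, y, hy, rfl⟩
    obtain ⟨y, hy⟩ := hne
    obtain ⟨p, hp⟩ := hG y x
    have hA := hA₀.act (hA₀.onV_eq hy ▸ Φ.isPath_map hp)
    exact ⟨_, hA, ⟨y, hy, Φ.act_map_onE hp⟩,
      le_antisymm (ncard_image_le (toFinite _)) (hmin _ _ hA)⟩
  refine Φ.stable_iff.2 ⟨?_, fun u J hu => ?_⟩
  · have h (c : H.E) (hc : H.src c = Φ.onV x) : Φ.onV (Φ.step x c) = H.tgt c :=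
      Φ.onV_act (w := [c]) ⟨hc, rfl⟩
    rw [h a ha, h b hb, hab]
  · replace hu : H.IsPath (H.tgt a) u J := by
      rwa [show Φ.onV (Φ.step x a) = H.tgt a from Φ.onV_act (w := [a]) ⟨ha, rfl⟩] at hu
    obtain ⟨I, w₀, hw₀, hA₀'⟩ := hA₀
    obtain ⟨w₁, hw₁⟩ := hH J I
    have hw : H.IsPath J (w₁ ++ w₀) L₀ := isPath_append.2 ⟨I, hw₁, hw₀⟩
    -- the path `w₀` maps a full fibre onto `A₀`, so both `a` and `b` followed by `u w₁ w₀` map the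
    -- minimal image `A` onto `A₀`
    have himage (c : H.E) (hc : H.src c = Φ.onV x) (hct : H.tgt c = H.tgt a) :
        (Φ.act · (c :: (u ++ (w₁ ++ w₀)))) '' A = A₀ := by
      have hp : H.IsPath (Φ.onV x) (c :: (u ++ w₁)) I :=
        ⟨hc, hct ▸ isPath_append.2 ⟨J, hu, hw₁⟩⟩
      refine eq_of_subset_of_ncard_le ?_ ?_ (toFinite _)
      · rw [hA₀']
        rintro _ ⟨y, hy, rfl⟩
        refine ⟨Φ.act y (c :: (u ++ w₁)), Φ.onV_act ((hA.onV_eq hy).symm ▸ hp), ?_⟩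
        change Φ.act _ w₀ = Φ.act y _
        rw [← act_append]
        simp
      · exact hmin L₀ _ (hA.act ⟨hc, hct ▸ isPath_append.2 ⟨J, hu, hw⟩⟩)
    have hinj : InjOn (Φ.act · (a :: (u ++ (w₁ ++ w₀)))) A :=
      injOn_of_ncard_image_eq (by rw [himage a ha rfl, hAc]) (toFinite _)
    refine ⟨w₁ ++ w₀, L₀, hw, ?_⟩
    obtain ⟨y, hy, hyx⟩ : Φ.act x (a :: (u ++ (w₁ ++ w₀))) ∈
        (Φ.act · (b :: (u ++ (w₁ ++ w₀)))) '' A := by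
      rw [himage b hb hab.symm, ← himage a ha rfl]
      exact mem_image_of_mem _ hxA
    by_cases hxy : y = x
    · subst hxy
      exact hyx.symm
    -- otherwise `a` acts on `y` as `b` does, and would identify `y` and `x`, both in `A`
    · refine absurd (hinj hy hxA (Eq.trans ?_ hyx)) hxy
      change Φ.act (Φ.step y a) _ = Φ.act (Φ.step y b) _
      rw [hstep y hxy (hA.onV_eq hy)]

/-! ### Relabelling -/

/-- Permuting, at each vertex of `G`, the labels of the outgoing edges among parallel edges of
`H`. -/
def relabel (Φ : RightResolver G H) (π : G.V → Equiv.Perm H.E)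
    (hs : ∀ I a, H.src (π I a) = H.src a) (ht : ∀ I a, H.tgt (π I a) = H.tgt a) :
    RightResolver G H :=
  Hom.toRightResolver
    ⟨Φ.onV, fun e => π (G.src e) (Φ.onE e), fun e => by rw [hs, Φ.src_onE],
      fun e => by rw [ht, Φ.tgt_onE]⟩ Φ.surjective_onV fun I => by
    refine ⟨?_, ?_, ?_⟩
    · rintro e rfl
      exact (hs _ _).trans (Φ.src_onE e)
    · intro e he e' he' h
      have hee : G.src e = G.src e' := he.trans he'.symm
      refine Φ.eq_of_onE_eq hee ((π (G.src e')).injective ?_)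
      change π (G.src e) _ = π (G.src e') _ at h
      rwa [hee] at h
    · intro a ha
      obtain ⟨e, rfl, he⟩ := Φ.exists_lift (I := I) (a := (π I).symm a)
        (by rw [← hs I, Equiv.apply_symm_apply]; exact ha)
      exact ⟨e, rfl, by simp [he]⟩

theorem exists_perm_of_parallel {p q a b : H.E} (hpq : p ≠ q) (hab : a ≠ b)
    (hsp : H.src p = H.src a) (hsq : H.src q = H.src a) (hsb : H.src b = H.src a)
    (htp : H.tgt p = H.tgt a) (htq : H.tgt q = H.tgt a) (htb : H.tgt b = H.tgt a) :
    ∃ π : Equiv.Perm H.E, (∀ e, H.src (π e) = H.src e ∧ H.tgt (π e) = H.tgt e) ∧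
      π p = a ∧ π q = b := by
  classical
  have hswap (c d : H.E) (hs : H.src c = H.src d) (ht : H.tgt c = H.tgt d) (e : H.E) :
      H.src (Equiv.swap c d e) = H.src e ∧ H.tgt (Equiv.swap c d e) = H.tgt e := by
    rw [Equiv.swap_apply_def]
    split_ifs with h₁ h₂
    · subst h₁; exact ⟨hs.symm, ht.symm⟩
    · subst h₂; exact ⟨hs, ht⟩
    · exact ⟨rfl, rfl⟩
  have h₁ := hswap p a hsp htp
  have h₂ := hswap (Equiv.swap p a q) b ((h₁ q).1.trans (hsq.trans hsb.symm))
    ((h₁ q).2.trans (htq.trans htb.symm))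
  refine ⟨(Equiv.swap p a).trans (Equiv.swap (Equiv.swap p a q) b), fun e =>
    ⟨(h₂ _).1.trans (h₁ e).1, (h₂ _).2.trans (h₁ e).2⟩, ?_, ?_⟩
  · rw [Equiv.trans_apply, Equiv.swap_apply_left, Equiv.swap_apply_of_ne_of_ne _ hab]
    intro h
    exact hpq ((Equiv.swap p a).injective (by rw [Equiv.swap_apply_left]; exact h))
  · rw [Equiv.trans_apply, Equiv.swap_apply_left]

/-- Let `a` and `b` be two edges from a vertex `x` whose ends lie over one vertex `J`. If each other
vertex in the fibre of `x` has two parallel edges that end over `J`, these can be given the labels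
of `a` and `b`, and then the ends of `a` and `b` become stable. -/
theorem exists_relabel_stable (Φ : RightResolver G M) (hG : G.StronglyConnected) {a b : G.E}
    (hsrc : G.src a = G.src b) (hne : a ≠ b)
    (htgt : Φ.onV (G.tgt a) = Φ.onV (G.tgt b))
    (hpair : ∀ y, y ≠ G.src a → Φ.onV y = Φ.onV (G.src a) → ∃ c d, c ≠ d ∧ G.src c = y ∧
      G.src d = y ∧ G.tgt c = G.tgt d ∧ Φ.onV (G.tgt c) = Φ.onV (G.tgt a)) :
    ∃ Φ' : RightResolver G M, Φ'.onV = Φ.onV ∧ Φ'.Stable (G.tgt a) (G.tgt b) := by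
  have hπ (y : G.V) : ∃ π : Equiv.Perm M.E,
      (∀ e, M.src (π e) = M.src e ∧ M.tgt (π e) = M.tgt e) ∧ (y = G.src a → π = 1) ∧
      (y ≠ G.src a → Φ.onV y = Φ.onV (G.src a) → ∃ c d, G.src c = y ∧ G.src d = y ∧
        G.tgt c = G.tgt d ∧ π (Φ.onE c) = Φ.onE a ∧ π (Φ.onE d) = Φ.onE b) := by
    by_cases hy : y ≠ G.src a ∧ Φ.onV y = Φ.onV (G.src a)
    · obtain ⟨c, d, hcd, hc, hd, ht, hca⟩ := hpair y hy.1 hy.2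
      obtain ⟨π, h, hπ⟩ := exists_perm_of_parallel (H := M) (p := Φ.onE c) (q := Φ.onE d)
        (a := Φ.onE a) (b := Φ.onE b) (fun h => hcd (Φ.eq_of_onE_eq (hc.trans hd.symm) h))
        (fun h => hne (Φ.eq_of_onE_eq hsrc h))
        (by rw [Φ.src_onE, Φ.src_onE, hc, hy.2]) (by rw [Φ.src_onE, Φ.src_onE, hd, hy.2])
        (by rw [Φ.src_onE, Φ.src_onE, hsrc]) (by rw [Φ.tgt_onE, Φ.tgt_onE, hca])
        (by rw [Φ.tgt_onE, Φ.tgt_onE, ← ht, hca]) (by rw [Φ.tgt_onE, Φ.tgt_onE, htgt])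
      exact ⟨π, h, fun h => absurd h hy.1, fun _ _ => ⟨c, d, hc, hd, ht, hπ⟩⟩
    · exact ⟨1, fun e => ⟨rfl, rfl⟩, fun _ => rfl, fun h h' => absurd ⟨h, h'⟩ hy⟩
  choose π hst hπx hπy using hπ
  let Φ' := Φ.relabel π (fun I e => (hst I e).1) (fun I e => (hst I e).2)
  have honE (e : G.E) : Φ'.onE e = π (G.src e) (Φ.onE e) := rfl
  have h1 := hπx (G.src a) rfl
  have ha : Φ'.onE a = Φ.onE a := by rw [honE, h1]; rfl
  have hb : Φ'.onE b = Φ.onE b := by rw [honE, ← hsrc, h1]; rfl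
  refine ⟨Φ', rfl, ?_⟩
  have := Φ'.stable_step_of_step_eq hG (x := G.src a) (a := Φ.onE a) (b := Φ.onE b)
    (Φ.src_onE a) (by rw [hsrc]; exact Φ.src_onE b) (by rw [Φ.tgt_onE, Φ.tgt_onE, htgt])
    fun y hy hyx => by
      obtain ⟨c, d, rfl, hd, ht, hπc, hπd⟩ := hπy y hy hyx
      rw [← hπc, ← honE c, step_onE, ht, ← Φ'.step_onE d, honE d, hd, hπd]
  rwa [← ha, ← hb, step_onE, hsrc, step_onE] at this

/-! ### Stability of the followers in a weakly almost bunchy graph -/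

/-- Weak almost bunchiness relative to an arbitrary right resolver: over any two vertices joined by
at least two edges there is at most one vertex whose corresponding edges have distinct ends. -/
def WeaklyAlmostBunchy (Φ : RightResolver G M) : Prop :=
  ∀ I J : M.V, 2 ≤ (M.edgesBetween I J).ncard →
    {I' | Φ.onV I' = I ∧ InjOn G.tgt (G.edgesInto I' (Φ.onV ⁻¹' {J}))}.Subsingleton

theorem WeaklyAlmostBunchy.of_comp {Φ : RightResolver G M} (h : Φ.WeaklyAlmostBunchy)
    (Ψ : RightResolver G H) (Θ : RightResolver H M) (hΘ : ∀ I, Θ.onV (Ψ.onV I) = Φ.onV I) :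
    Θ.WeaklyAlmostBunchy := by
  rintro I J hIJ c₁ ⟨hc₁, hi₁⟩ c₂ ⟨hc₂, hi₂⟩
  have key (c : H.V) (hc : Θ.onV c = I)
      (hi : InjOn H.tgt (H.edgesInto c (Θ.onV ⁻¹' {J}))) :
      ∃ I', Ψ.onV I' = c ∧ I' ∈ {I' | Φ.onV I' = I ∧
        InjOn G.tgt (G.edgesInto I' (Φ.onV ⁻¹' {J}))} := by
    obtain ⟨I', rfl⟩ := Ψ.surjective_onV c
    refine ⟨I', rfl, (hΘ I').symm.trans hc, ?_⟩
    rintro e ⟨he, heJ⟩ e' ⟨he', heJ'⟩ hee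
    refine Ψ.eq_of_onE_eq (he.trans he'.symm) (hi ⟨?_, ?_⟩ ⟨?_, ?_⟩ ?_)
    · rw [Ψ.src_onE, he]
    · rw [mem_preimage, Ψ.tgt_onE, hΘ]; exact heJ
    · rw [Ψ.src_onE, he']
    · rw [mem_preimage, Ψ.tgt_onE, hΘ]; exact heJ'
    · rw [Ψ.tgt_onE, Ψ.tgt_onE, hee]
  obtain ⟨I₁, rfl, h₁⟩ := key c₁ hc₁ hi₁
  obtain ⟨I₂, rfl, h₂⟩ := key c₂ hc₂ hi₂
  rw [h I J hIJ h₁ h₂]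

/-- A weakly almost bunchy graph in which some vertex has two followers over one vertex of `M`
has a nontrivial stable pair after relabelling. The vertex that keeps distinct ends for the two
chosen labels is the one with the maximal number of followers, if there is such a vertex. -/
theorem WeaklyAlmostBunchy.exists_stable {Φ : RightResolver G M} (h : Φ.WeaklyAlmostBunchy)
    (hG : G.StronglyConnected) {a b : G.E} (hs : G.src a = G.src b) (hne : G.tgt a ≠ G.tgt b)
    (ht : Φ.onV (G.tgt a) = Φ.onV (G.tgt b)) :
    ∃ (Φ' : RightResolver G M) (p q : G.V), Φ'.onV = Φ.onV ∧ p ≠ q ∧ Φ'.Stable p q := by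
  set I := Φ.onV (G.src a) with hI
  set J := Φ.onV (G.tgt a) with hJ
  have hcard : 2 ≤ (M.edgesBetween I J).ncard := by
    refine (one_lt_ncard_iff (toFinite _)).2 ⟨Φ.onE a, Φ.onE b, ⟨Φ.src_onE a, Φ.tgt_onE a⟩,
      ⟨by rw [Φ.src_onE, ← hs], by rw [Φ.tgt_onE, ht]⟩, fun hab => hne ?_⟩
    rw [Φ.eq_of_onE_eq hs hab]
  obtain ⟨c, d, hcd, hcs, hct, hdt, hcne, hother⟩ : ∃ c d, G.src c = G.src d ∧
      Φ.onV (G.src c) = I ∧ Φ.onV (G.tgt c) = J ∧ Φ.onV (G.tgt d) = J ∧ G.tgt c ≠ G.tgt d ∧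
      ∀ y, y ≠ G.src c → Φ.onV y = I → ¬ InjOn G.tgt (G.edgesInto y (Φ.onV ⁻¹' {J})) := by
    by_cases hx : ∃ x, Φ.onV x = I ∧ InjOn G.tgt (G.edgesInto x (Φ.onV ⁻¹' {J}))
    · obtain ⟨x, hxI, hx⟩ := hx
      have h2 : 1 < (G.edgesInto x (Φ.onV ⁻¹' {J})).ncard := by
        rw [Φ.ncard_edgesInto, hxI]
        exact hcard
      obtain ⟨c, d, hc, hd, hcd⟩ := (one_lt_ncard_iff (toFinite _)).1 h2
      refine ⟨c, d, hc.1.trans hd.1.symm, by rw [hc.1, hxI], hc.2, hd.2,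
        fun h => hcd (hx hc hd h), fun y hy hyI hinj => hy ?_⟩
      rw [hc.1]
      exact h I J hcard ⟨hyI, hinj⟩ ⟨hxI, hx⟩
    · exact ⟨a, b, hs, rfl, rfl, ht.symm, hne, fun y _ hyI hinj => hx ⟨y, hyI, hinj⟩⟩
  obtain ⟨Φ', hΦ', hst⟩ := Φ.exists_relabel_stable hG hcd (fun h => hcne (by rw [h]))
    (hct.trans hdt.symm) fun y hy hyI => by
      have := hother y hy (hyI.trans hcs)
      simp only [InjOn, not_forall] at this
      obtain ⟨e, he, e', he', hee, hne⟩ := this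
      exact ⟨e, e', hne, he.1, he'.1, hee, he.2.trans hct.symm⟩
  exact ⟨Φ', _, _, hΦ', hcne, hst⟩

/-- The edges can be relabelled so that any two followers of a vertex over one vertex of `M` are
stable: as long as there are two distinct such followers, there is a nontrivial stable pair for
some labelling, and the quotient by its stability relation is a smaller graph. -/
theorem WeaklyAlmostBunchy.exists_forall_stable {Φ₀ : RightResolver G M}
    (h : Φ₀.WeaklyAlmostBunchy) (hG : G.StronglyConnected) :
    ∃ Φ : RightResolver G M, Φ.onV = Φ₀.onV ∧ ∀ e e', G.src e = G.src e' →
      Φ₀.onV (G.tgt e) = Φ₀.onV (G.tgt e') → Φ.Stable (G.tgt e) (G.tgt e') := by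
  induction hn : Nat.card G.V using Nat.strong_induction_on generalizing G with
  | _ n ih =>
  by_cases hb : ∀ e e', G.src e = G.src e' →
      Φ₀.onV (G.tgt e) = Φ₀.onV (G.tgt e') → G.tgt e = G.tgt e'
  · refine ⟨Φ₀, rfl, fun e e' hs ht => ?_⟩
    rw [hb e e' hs ht]
    exact Φ₀.stableSetoid.refl _
  push Not at hb
  obtain ⟨a, b, hs, ht, hne⟩ := hb
  obtain ⟨Φ, p, q, hΦ, hpq, hst⟩ := h.exists_stable hG hs hne ht
  obtain ⟨Ψ, Θ, hΨ, hcomp⟩ := Φ.exists_factor_quot Φ.stableSetoid (fun _ _ h => h.1)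
    fun _ _ h he => Stable.tgt h he
  have hsync : Ψ.IsSynchronizing := isSynchronizing_of_comp (Θ := Θ) fun I₁ I₂ hI => by
    rw [hΨ] at hI
    rw [hcomp]
    exact Quotient.exact hI
  have hlt : Nat.card (G.quot Φ.stableSetoid).V < n := by
    rw [← hn]
    refine (Nat.card_le_card_of_surjective _ Ψ.surjective_onV).lt_of_ne fun hcard => hpq ?_
    refine ((Nat.bijective_iff_surjective_and_card _).2 ⟨Ψ.surjective_onV, hcard.symm⟩).1 ?_
    rw [hΨ]
    exact Quotient.sound hst
  have hV₀ : ∀ I, Θ.onV (Ψ.onV I) = Φ₀.onV I := fun I =>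
    (congrArg (fun Φ' : RightResolver G M => Φ'.onV I) hcomp).trans (congrFun hΦ I)
  obtain ⟨Θ', hΘ', hstab⟩ := ih _ hlt (h.of_comp Ψ Θ hV₀) (hG.of_rightResolver Ψ) rfl
  refine ⟨Θ'.comp Ψ, funext fun I => ?_, fun e e' hs ht => hsync.stable_comp ?_⟩
  · change Θ'.onV (Ψ.onV I) = _
    rw [hΘ', hV₀]
  · rw [← Ψ.tgt_onE, ← Ψ.tgt_onE]
    exact hstab _ _ (by rw [Ψ.src_onE, Ψ.src_onE, hs])
      (by rw [Ψ.tgt_onE, Ψ.tgt_onE, hV₀, hV₀, ht])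

end RightResolver

/-! ### The maximal bunchy factor -/

/-- An equivalence relation on the vertices is bunched if it refines the fibres of `Σ_G` and, for
related `I` and `I'`, relates all followers of `I` to all followers of `I'` over the same vertex
of `M(G)`. Such relations are the kernels of the right resolvers from `G` to bunchy graphs. -/
def IsBunched (s : Setoid G.V) : Prop :=
  (∀ I I', s I I' → G.minimalMap I = G.minimalMap I') ∧
    ∀ e e', s (G.src e) (G.src e') → G.minimalMap (G.tgt e) = G.minimalMap (G.tgt e') →
      s (G.tgt e) (G.tgt e')

theorem RightResolver.isBunched_ker (Φ : RightResolver G H) (hH : Bunchy H) :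
    IsBunched (Setoid.ker Φ.onV) := by
  refine ⟨fun I I' h => Φ.minimalMap_eq_iff.1 (congrArg H.minimalMap h), fun e e' hs ht => ?_⟩
  change Φ.onV _ = Φ.onV _ at hs
  change Φ.onV _ = Φ.onV _
  rw [← Φ.tgt_onE, ← Φ.tgt_onE]
  refine bunchy_iff.1 hH _ _ (by rw [Φ.src_onE, Φ.src_onE, hs]) ?_
  rwa [Φ.tgt_onE, Φ.tgt_onE, Φ.minimalMap_eq_iff]

/-- The finest bunched equivalence relation, whose quotient is `B(G)`. -/
def bunchedSetoid (G : FinDigraph.{u, v}) : Setoid G.V := sInf {s | IsBunched s}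

theorem bunchedSetoid_le {s : Setoid G.V} (hs : IsBunched s) : G.bunchedSetoid ≤ s :=
  sInf_le hs

theorem isBunched_bunchedSetoid (G : FinDigraph.{u, v}) : IsBunched G.bunchedSetoid := by
  have hker : IsBunched (Setoid.ker G.minimalMap) := ⟨fun _ _ h => h, fun _ _ _ h => h⟩
  exact ⟨fun I I' h => bunchedSetoid_le hker h,
    fun e e' hs ht s hs' => hs'.2 e e' (bunchedSetoid_le hs' hs) ht⟩

theorem RightResolver.bunchy_of_isBunched (Ψ : RightResolver G H)
    (h : IsBunched (Setoid.ker Ψ.onV)) : Bunchy H := by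
  refine bunchy_iff.2 fun a a' hs ht => ?_
  obtain ⟨I, hI⟩ := Ψ.surjective_onV (H.src a)
  obtain ⟨e, rfl, rfl⟩ := Ψ.exists_lift hI.symm
  obtain ⟨e', he, rfl⟩ := Ψ.exists_lift (hs.symm.trans hI.symm)
  rw [Ψ.tgt_onE, Ψ.tgt_onE] at ht ⊢
  exact h.2 e e' (congrArg Ψ.onV he.symm) (Ψ.minimalMap_eq_iff.1 ht)

theorem RFactor.isomorphic (h : RFactor H G) (h' : RFactor G H) : Isomorphic G H := by
  obtain ⟨Φ⟩ := h
  obtain ⟨Ψ⟩ := h'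
  have hV : Function.Bijective Φ.onV :=
    (Nat.bijective_iff_surjective_and_card _).2 ⟨Φ.surjective_onV,
      le_antisymm (Nat.card_le_card_of_surjective _ Ψ.surjective_onV)
        (Nat.card_le_card_of_surjective _ Φ.surjective_onV)⟩
  refine ⟨Φ.toHom, hV, fun e e' h => Φ.eq_of_onE_eq (hV.1 ?_) h, Φ.surjective_onE⟩
  rw [← Φ.src_onE, ← Φ.src_onE, h]

theorem WeaklyAlmostBunchy.rightResolver (h : G.WeaklyAlmostBunchy)
    {σ : RightResolver G G.minimalFactor} (hσ : σ.onV = G.minimalMap) :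
    σ.WeaklyAlmostBunchy := by
  intro I J hIJ
  refine (h I J hIJ).anti ?_
  rintro I' ⟨rfl, hinj⟩
  refine ⟨by rw [hσ], ?_⟩
  have himage : G.tgt '' G.edgesInto I' (σ.onV ⁻¹' {J}) =
      G.minimalMap ⁻¹' {J} ∩ G.followers I' := by
    rw [hσ]
    ext K
    constructor
    · rintro ⟨e, ⟨he, heJ⟩, rfl⟩
      exact ⟨heJ, e, he, rfl⟩
    · rintro ⟨hK, e, he, rfl⟩
      exact ⟨e, ⟨he, hK⟩, rfl⟩
  rw [← himage, hinj.ncard_image, σ.ncard_edgesInto]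
  rfl

end FinDigraph

theorem mainTheorem1 (G : FinDigraph.{u, v}) (hG : G.StronglyConnected)
    (hwab : G.WeaklyAlmostBunchy) :
    ∃ B : FinDigraph.{u, v}, FinDigraph.IsMaximalBunchyFactor G B ∧
      (∀ B' : FinDigraph.{u, v}, FinDigraph.IsMaximalBunchyFactor G B' →
        FinDigraph.Isomorphic B' B) ∧
      FinDigraph.SFactor B G := by
  obtain ⟨σ, hσ⟩ := G.exists_onV_eq_minimalMap
  obtain ⟨Φ, hΦ, hstab⟩ := (hwab.rightResolver hσ).exists_forall_stable hG
  rw [hσ] at hΦ hstab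
  set s := G.bunchedSetoid
  have hs : FinDigraph.IsBunched s := G.isBunched_bunchedSetoid
  -- the stability relation is bunched: edges with different labels from stable vertices are
  -- compared through an edge that shares its source with one and its label with the other
  have hle : s ≤ Φ.stableSetoid := by
    refine FinDigraph.bunchedSetoid_le ⟨fun I I' h => hΦ ▸ h.1, fun e e' h ht => ?_⟩
    obtain ⟨e'', he'', hl⟩ := Φ.exists_lift (I := G.src e') (a := Φ.onE e)
      (by rw [Φ.src_onE, h.1])
    have ht' : G.minimalMap (G.tgt e'') = G.minimalMap (G.tgt e) := by
      rw [← hΦ, ← Φ.tgt_onE, hl, Φ.tgt_onE]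
    exact Φ.stableSetoid.trans (FinDigraph.RightResolver.Stable.tgt (he'' ▸ h) hl.symm)
      (hstab e'' e' he'' (ht'.trans ht))
  obtain ⟨Ψ, Θ, hΨ, hcomp⟩ := Φ.exists_factor_quot s (fun I I' h => hΦ ▸ hs.1 I I' h)
    fun e e' h he => hs.2 e e' h (by rw [← hΦ, ← Φ.tgt_onE, he, Φ.tgt_onE])
  have hker : Setoid.ker Ψ.onV = s := by rw [hΨ]; exact Setoid.ker_mk_eq s
  have hB : FinDigraph.Bunchy (G.quot s) := Ψ.bunchy_of_isBunched (by rw [hker]; exact hs)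
  have huniv (H : FinDigraph.{u, v}) (hHG : FinDigraph.RFactor H G) (hH : H.Bunchy) :
      FinDigraph.RFactor H (G.quot s) := by
    obtain ⟨Ω⟩ := hHG
    obtain ⟨Ω', -⟩ := Ψ.exists_factor Ω fun I I' h =>
      FinDigraph.bunchedSetoid_le (Ω.isBunched_ker hH) (hker ▸ h : s I I')
    exact ⟨Ω'⟩
  refine ⟨G.quot s, ⟨⟨Ψ⟩, hB, fun H hHG hH _ => huniv H hHG hH⟩, fun B' hB' => ?_, Ψ, ?_⟩
  · have h := huniv B' hB'.1 hB'.2.1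
    exact (hB'.2.2 _ ⟨Ψ⟩ hB h).isomorphic h
  · exact FinDigraph.RightResolver.isSynchronizing_of_comp (Θ := Θ) fun I₁ I₂ h => by
      rw [hcomp]
      exact hle (hker ▸ h : s I₁ I₂)
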